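/- Let $n,K\ge 1$ be integers, let $\mathcal C$ be a nonempty finite class of $N$ subsets of $\{1,\dots,n\}$, each of cardinality $K$, and let $\mu>0$. Let $\mathbb P_0$ be the law on $\mathbb R^n$ under which the coordinates $X_1,\dots,X_n$ are i.i.d. $\mathcal N(0,1)$, with expectation $\mathbb E_0$. For $S\in\mathcal C$ let $\mathbb P_S$ be the law under which the coordinates are independent, with $X_i\sim\mathcal N(\mu,1)$ for $i\in S$ and $X_i\sim\mathcal N(0,1)$ for $i\notin S$. The risk of a test $f:\mathbb R^n\to\{0,1\}$ is $$R(f)=\mathbb P_0\{f(X)=1\}+\frac1N\sum_{S\in\mathcal C}\mathbb P_S\{f(X)=0\}.$$ Write $X_S=\sum_{i\in S}X_i$, and let $f$ be the maximum (scan) test, defined by $$f(X)=1\quad\text{if and only if}\quad \max_{S\in\mathcal C}X_S\ \ge\ \frac{\mu K+\mathbb E_0\max_{S\in\mathcal C}X_S}{2}.$$ Then, for every $\delta>0$, $R(f)\le\delta$ whenever $$\mu\ \ge\ \frac{\mathbb E_0\max_{S\in\mathcal C}X_S}{K}+2\sqrt{\frac2K\log\frac2\delta}$$ (the square root being read as $0$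 if $\delta>2$, in which case the bound is trivial). -/

import Mathlib

open MeasureTheory ProbabilityTheory

noncomputable section

namespace CombTest

/-- The law `P₀` of the observation under the null hypothesis: the coordinates are i.i.d. `N(0,1)`. -/
def nullLaw (n : ℕ) : Measure (Fin n → ℝ) :=
  Measure.pi fun _ => gaussianReal 0 1

/-- The law `P_S`: the coordinates are independent, `N(μ,1)` inside `S` and `N(0,1)` outside `S`. -/
def altLaw {n : ℕ} (μ : ℝ) (S : Finset (Fin n)) : Measure (Fin n → ℝ) :=
  Measure.pi fun i => gaussianReal (if i ∈ S then μ else 0) 1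

/-- The risk of a binary-valued test `f`: the type I error plus the type II error averaged
over the class `C`. -/
def risk {n : ℕ} (C : Finset (Finset (Fin n))) (μ : ℝ) (f : (Fin n → ℝ) → Fin 2) : ℝ :=
  (nullLaw n).real {x | f x = 1}
    + (1 / (C.card : ℝ)) * ∑ S ∈ C, (altLaw μ S).real {x | f x = 0}

/-- The scan statistic: the maximum over `S ∈ C` of `∑ i ∈ S, x i`. -/
def scan {n : ℕ} (C : Finset (Finset (Fin n))) (hC : C.Nonempty) (x : Fin n → ℝ) : ℝ :=
  C.sup' hC fun S => ∑ i ∈ S, x i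

/-- The expectation of the scan statistic under the null hypothesis. -/
def scanMean {n : ℕ} (C : Finset (Finset (Fin n))) (hC : C.Nonempty) : ℝ :=
  ∫ x, scan C hC x ∂(nullLaw n)

open Classical in
/-- The maximum test: it takes the value `1` (rejects) exactly when the scan statistic is at
least the midpoint of `μ K` and its null expectation. -/
def maxTest {n : ℕ} (C : Finset (Finset (Fin n))) (hC : C.Nonempty) (K : ℕ) (μ : ℝ)
    (x : Fin n → ℝ) : Fin 2 :=
  if (μ * K + scanMean C hC) / 2 ≤ scan C hC x then 1 else 0

/-- The scan statistic is integrable under the null, so `scanMean` is a genuine expectation. -/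
theorem integrable_scan {n : ℕ} (C : Finset (Finset (Fin n))) (hC : C.Nonempty) :
    Integrable (scan C hC) (nullLaw n) := by
  have h1 : ∀ S : Finset (Fin n), Integrable (fun x : Fin n → ℝ => ∑ i ∈ S, x i) (nullLaw n) := by
    intro S
    refine integrable_finsetSum S fun i _ => ?_
    have hp := measurePreserving_eval (fun _ : Fin n => gaussianReal 0 1) i
    have hid : Integrable (id : ℝ → ℝ) (gaussianReal 0 1) :=
      memLp_one_iff_integrable.1 (memLp_id_gaussianReal 1)
    exact hp.integrable_comp_of_integrable hid
  have h2 : scan C hC = C.sup' hC (fun S => fun x : Fin n → ℝ => ∑ i ∈ S, x i) := by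
    funext x
    simp [scan, Finset.sup'_apply]
  rw [h2]
  exact Finset.sup'_induction hC _ (p := fun g => Integrable g (nullLaw n))
    (fun _ ha _ hb => ha.sup hb) (fun S _ => h1 S)

end CombTest

end

/-! Both errors are Gaussian tails at distance t = (μK - E₀ max X_S)/2. Under P_S the scan statistic
dominates X_S, which has law N(μK, K), and the threshold lies t below μK. Under P₀ the threshold
lies t above the mean of the scan statistic, a maximum of √K-Lipschitz functions. So each error is
at most exp(-t²/(2K)), and the hypothesis on μ makes this at most δ/2.

The null bound needs Gaussian concentration with the sharp constant, proved by interpolation. For X,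
Y independent standard Gaussian and X_θ = cos θ X + sin θ Y, the correlation E[exp(tF(X)) F(X_θ)]
goes from E[F exp(tF)] at θ = 0 to E[F] E[exp(tF)] at θ = π/2. Rotation invariance and integration
by parts bound its derivative below (`deriv_rotationCorrelation_ge`). Integrating in θ gives a
differential inequality for the moment generating function (`integral_mul_exp_le`), hence
sub-Gaussianity.

The maximum is not differentiable, so this is applied to its log-sum-exp smoothing (`softScan`),
whose gradients have entries in [0,1] summing to K. The smoothing error then tends to zero. -/

namespace GaussianConcentration

/-- The standard Gaussian measure on `ι → ℝ`, as a product measure. -/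
noncomputable abbrev stdGaussianPi (ι : Type*) [Fintype ι] : Measure (ι → ℝ) :=
  Measure.pi fun _ => gaussianReal 0 1

/-! ### Product Gaussian measure and resampling of a coordinate -/

section Basic

variable {ι : Type*} [Fintype ι]

/-- Gives access to Fernique's theorem and to rotation invariance; the latter also requires the
measure to be centred. -/
instance isGaussian_stdGaussianPi : IsGaussian (stdGaussianPi ι) := by
  have h : stdGaussianPi ι = (stdGaussian (EuclideanSpace ℝ ι)).map
      (EuclideanSpace.equiv ι ℝ : EuclideanSpace ℝ ι →L[ℝ] ι → ℝ) := by
    rw [← map_pi_eq_stdGaussian, Measure.map_map (by fun_prop) (by fun_prop)]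
    exact Measure.map_id.symm
  rw [h]
  infer_instance

lemma integral_id_stdGaussianPi : ∫ x, id x ∂(stdGaussianPi ι) = 0 := by
  funext i
  rw [eval_integral]
  · have h := integral_comp_eval (μ := fun _ : ι => gaussianReal 0 1) (i := i) (f := id)
      aestronglyMeasurable_id
    simpa using h
  · exact fun i => (integrable_pi_iff.1 IsGaussian.integrable_id) i

/-- Resampling one coordinate preserves a product probability measure. -/
lemma measurePreserving_update [DecidableEq ι] {Ω : ι → Type*} [∀ i, MeasurableSpace (Ω i)]
    (ν : ∀ i, Measure (Ω i)) [∀ i, IsProbabilityMeasure (ν i)] (i : ι) :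
    MeasurePreserving (fun p : (∀ j, Ω j) × Ω i => Function.update p.1 i p.2)
      ((Measure.pi ν).prod (ν i)) (Measure.pi ν) := by
  have hm : Measurable (fun p : (∀ j, Ω j) × Ω i => Function.update p.1 i p.2) := by
    refine measurable_pi_lambda _ fun j => ?_
    by_cases h : j = i
    · subst h; simpa using measurable_snd
    · simp only [Function.update_of_ne h]
      exact (measurable_pi_apply j).comp measurable_fst
  refine ⟨hm, (Measure.pi_eq fun s hs => ?_).symm⟩
  have hpre : (fun p : (∀ j, Ω j) × Ω i => Function.update p.1 i p.2) ⁻¹' (Set.univ.pi s)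
      = (Set.univ.pi (Function.update s i Set.univ)) ×ˢ s i := by
    ext p
    simp only [Set.mem_preimage, Set.mem_pi, Set.mem_univ, forall_const, Set.mem_prod]
    constructor
    · refine fun h => ⟨fun j => ?_, by simpa using h i⟩
      by_cases hj : j = i
      · subst hj; simp
      · simpa [hj] using h j
    · rintro ⟨h1, h2⟩ j
      by_cases hj : j = i
      · subst hj; simpa using h2
      · simpa [hj] using h1 j
  rw [Measure.map_apply hm (MeasurableSet.univ_pi hs), hpre, Measure.prod_prod, Measure.pi_pi,
    Fintype.prod_eq_mul_prod_compl i, Fintype.prod_eq_mul_prod_compl i (fun j => ν j (s j)),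
    Function.update_self, measure_univ, one_mul, mul_comm]
  congr 1
  refine Finset.prod_congr rfl fun j hj => ?_
  rw [Function.update_of_ne (by simpa using hj)]

end Basic

/-! ### Gaussian integration by parts -/

section Stein

lemma hasDerivAt_gaussianPDFReal (x : ℝ) :
    HasDerivAt (gaussianPDFReal 0 1) (-x * gaussianPDFReal 0 1 x) x := by
  have h : HasDerivAt (fun y : ℝ => (√(2 * Real.pi * (1 : NNReal)))⁻¹ *
      Real.exp (-(y - 0) ^ 2 / (2 * (1 : NNReal)))) ((√(2 * Real.pi * (1 : NNReal)))⁻¹ *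
      (Real.exp (-(x - 0) ^ 2 / (2 * (1 : NNReal))) * (-x))) x := by
    refine (HasDerivAt.exp ?_).const_mul _
    have := ((((hasDerivAt_id x).sub_const 0).pow 2).neg).div_const (2 * ((1 : NNReal) : ℝ))
    refine this.congr_deriv ?_
    simp
    ring
  refine h.congr_deriv ?_
  simp only [gaussianPDFReal]
  ring

lemma integrable_gaussianReal_iff {f : ℝ → ℝ} :
    Integrable f (gaussianReal 0 1) ↔ Integrable fun x => gaussianPDFReal 0 1 x * f x := by
  rw [gaussianReal_of_var_ne_zero _ one_ne_zero,
    integrable_withDensity_iff_integrable_smul' (measurable_gaussianPDF 0 1)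
      (Filter.Eventually.of_forall fun _ => gaussianPDF_lt_top)]
  simp [toReal_gaussianPDF]

/-- Gaussian integration by parts on the real line. -/
lemma integral_mul_gaussianReal {h h' : ℝ → ℝ} (hd : ∀ x, HasDerivAt h (h' x) x)
    (hi : Integrable h (gaussianReal 0 1)) (hi' : Integrable h' (gaussianReal 0 1))
    (hx : Integrable (fun x => x * h x) (gaussianReal 0 1)) :
    ∫ x, x * h x ∂(gaussianReal 0 1) = ∫ x, h' x ∂(gaussianReal 0 1) := by
  rw [integrable_gaussianReal_iff] at hi hi' hx
  have key := integral_mul_deriv_eq_deriv_mul_of_integrable (u := gaussianPDFReal 0 1) (v := h)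
    (u' := fun x => -x * gaussianPDFReal 0 1 x) (v' := h')
    (fun x _ => hasDerivAt_gaussianPDFReal x) (fun x _ => hd x) hi'
    (by refine hx.neg.congr (Filter.Eventually.of_forall fun x => ?_)
        simp only [Pi.neg_apply, Pi.mul_apply]; ring) hi
  rw [integral_gaussianReal_eq_integral_smul one_ne_zero,
    integral_gaussianReal_eq_integral_smul one_ne_zero]
  simp only [smul_eq_mul]
  rw [key, ← integral_neg]
  refine integral_congr_ae (Filter.Eventually.of_forall fun x => ?_)
  simp only
  ring

variable {ι : Type*} [Fintype ι] [DecidableEq ι]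

/-- Gaussian integration by parts in one coordinate of a standard Gaussian vector. -/
lemma integral_apply_mul_stdGaussianPi (i : ι) {h h' : (ι → ℝ) → ℝ}
    (hd : ∀ x y, HasDerivAt (fun t => h (Function.update x i t)) (h' (Function.update x i y)) y)
    (hi : Integrable h (stdGaussianPi ι)) (hi' : Integrable h' (stdGaussianPi ι))
    (hx : Integrable (fun x => x i * h x) (stdGaussianPi ι)) :
    ∫ x, x i * h x ∂(stdGaussianPi ι) = ∫ x, h' x ∂(stdGaussianPi ι) := by
  have hmp := measurePreserving_update (fun _ : ι => gaussianReal 0 1) i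
  -- Fubini in coordinate `i` without splitting the product: resampling that coordinate preserves
  -- the law, so the claim reduces to the real line for almost every `x`.
  have hfub : ∀ g : (ι → ℝ) → ℝ, Integrable g (stdGaussianPi ι) →
      (∀ᵐ x ∂(stdGaussianPi ι), Integrable (fun y => g (Function.update x i y))
        (gaussianReal 0 1)) ∧
      ∫ x, g x ∂(stdGaussianPi ι) =
        ∫ x, ∫ y, g (Function.update x i y) ∂(gaussianReal 0 1) ∂(stdGaussianPi ι) := by
    intro g hg
    have h1 := hmp.integrable_comp_of_integrable hg
    refine ⟨h1.prod_right_ae, ?_⟩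
    conv_lhs => rw [stdGaussianPi, ← hmp.map_eq]
    rw [integral_map hmp.measurable.aemeasurable (by rw [hmp.map_eq]; exact hg.1)]
    exact integral_prod _ h1
  obtain ⟨a1, -⟩ := hfub _ hi
  obtain ⟨a2, e2⟩ := hfub _ hi'
  obtain ⟨a3, e3⟩ := hfub _ hx
  rw [e2, e3]
  refine integral_congr_ae ?_
  filter_upwards [a1, a2, a3] with x h1 h2 h3
  simp only [Function.update_self] at h3 ⊢
  exact integral_mul_gaussianReal (hd x) h1 h2 h3

end Stein

/-! ### Integrability from linear growth, by Fernique's theorem -/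

section LinearGrowth

variable {E : Type*} [NormedAddCommGroup E] [NormedSpace ℝ E] [MeasurableSpace E] [BorelSpace E]
  [SecondCountableTopology E] [CompleteSpace E] {μ : Measure E} [IsGaussian μ]

lemma integrable_exp_of_linear_growth {f : E → ℝ} (hf : Measurable f) {a L : ℝ}
    (hb : ∀ x, |f x| ≤ a + L * ‖x‖) : Integrable (fun x => Real.exp (f x)) μ := by
  obtain ⟨C, hC, hint⟩ := IsGaussian.exists_integrable_exp_sq μ
  -- The constant comes from completing the square: L‖x‖ ≤ C‖x‖² + L²/(4C).
  refine (hint.const_mul (Real.exp (a + L ^ 2 / (4 * C)))).mono' (by fun_prop)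
    (Filter.Eventually.of_forall fun x => ?_)
  rw [Real.norm_eq_abs, Real.abs_exp, ← Real.exp_add]
  refine Real.exp_le_exp.2 ?_
  have h1 := (le_abs_self _).trans (hb x)
  have h2 : L ^ 2 / (4 * C) + C * ‖x‖ ^ 2 - L * ‖x‖ = C * (‖x‖ - L / (2 * C)) ^ 2 := by
    field_simp
    ring
  have h3 : 0 ≤ C * (‖x‖ - L / (2 * C)) ^ 2 := by positivity
  linarith

lemma memLp_two_exp_of_linear_growth {f : E → ℝ} (hf : Measurable f) {a L : ℝ}
    (hb : ∀ x, |f x| ≤ a + L * ‖x‖) : MemLp (fun x => Real.exp (f x)) 2 μ := by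
  rw [memLp_two_iff_integrable_sq (by fun_prop)]
  have h := integrable_exp_of_linear_growth (μ := μ) (f := fun x => 2 * f x) (by fun_prop)
    (a := 2 * a) (L := 2 * L) (fun x => by rw [abs_mul, abs_two]; linarith [hb x])
  refine h.congr (Filter.Eventually.of_forall fun x => ?_)
  simp only
  rw [← Real.exp_nat_mul]
  norm_num

lemma memLp_two_of_linear_growth {f : E → ℝ} (hf : Measurable f) {a L : ℝ}
    (hb : ∀ x, |f x| ≤ a + L * ‖x‖) : MemLp f 2 μ := by
  have h : MemLp (fun x : E => a + L * ‖x‖) 2 μ :=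
    (memLp_const a).add ((IsGaussian.memLp_two_id (μ := μ)).norm.const_mul L)
  refine h.mono hf.aestronglyMeasurable (Filter.Eventually.of_forall fun x => ?_)
  rw [Real.norm_eq_abs, Real.norm_eq_abs]
  exact (hb x).trans (le_abs_self _)

end LinearGrowth

/-- The differential of a function on `ι → ℝ` with partial derivatives `g`. -/
noncomputable def differential {ι : Type*} [Fintype ι] (g : ι → ℝ) : (ι → ℝ) →L[ℝ] ℝ :=
  ∑ i, g i • ContinuousLinearMap.proj (R := ℝ) (φ := fun _ : ι => ℝ) i

lemma differential_apply {ι : Type*} [Fintype ι] (g v : ι → ℝ) :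
    differential g v = ∑ i, g i * v i := by
  simp [differential]

/-! ### Growth of functions with bounded gradient -/

section Gradient

variable {ι : Type*} [Fintype ι] {F : (ι → ℝ) → ℝ} {G : (ι → ℝ) → ι → ℝ} {c : ℝ}

lemma abs_gradient_le (hc : ∀ x y, ∑ i, G x i * G y i ≤ c) (x : ι → ℝ) (i : ι) :
    |G x i| ≤ √c := by
  refine Real.abs_le_sqrt ((?_ : G x i ^ 2 ≤ ∑ i, G x i * G x i).trans (hc x x))
  rw [sq]
  exact Finset.single_le_sum (f := fun i => G x i * G x i) (fun i _ => mul_self_nonneg _)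
    (Finset.mem_univ i)

/-- The dimensional factor is the price of the sup norm. It is harmless, since this bound serves
only integrability and domination, never the final constant. -/
lemma abs_differential_le (hc : ∀ x y, ∑ i, G x i * G y i ≤ c) (x v : ι → ℝ) :
    |∑ i, G x i * v i| ≤ (Fintype.card ι * √c) * ‖v‖ := by
  refine (Finset.abs_sum_le_sum_abs _ _).trans ?_
  have h : ∀ i ∈ Finset.univ, |G x i * v i| ≤ √c * ‖v‖ := fun i _ => by
    rw [abs_mul]
    exact mul_le_mul (abs_gradient_le hc x i) (norm_le_pi_norm v i) (abs_nonneg _)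
      (Real.sqrt_nonneg _)
  refine (Finset.sum_le_card_nsmul _ _ _ h).trans_eq ?_
  rw [nsmul_eq_mul, Finset.card_univ, mul_assoc]

lemma abs_le_of_gradient (hF : ∀ x, HasFDerivAt F (differential (G x)) x)
    (hc : ∀ x y, ∑ i, G x i * G y i ≤ c) (x : ι → ℝ) :
    |F x| ≤ |F 0| + (Fintype.card ι * √c) * ‖x‖ := by
  have h := convex_univ.norm_image_sub_le_of_norm_hasFDerivWithin_le (f := F)
    (C := Fintype.card ι * √c)
    (fun x _ => (hF x).hasFDerivWithinAt)
    (fun x _ => ContinuousLinearMap.opNorm_le_bound _ (by positivity) fun v => by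
      rw [differential_apply]; exact abs_differential_le hc x v)
    (Set.mem_univ 0) (Set.mem_univ x)
  rw [sub_zero, Real.norm_eq_abs] at h
  have := abs_sub_abs_le_abs_sub (F x) (F 0)
  linarith

end Gradient

/-! ### Interpolation along Gaussian rotations -/

section Interpolation

variable {ι : Type*} [Fintype ι] {F : (ι → ℝ) → ℝ} {G : (ι → ℝ) → ι → ℝ} {c : ℝ}

/-- The correlation of `exp (t F)` at one end of a Gaussian rotation with `F` at the other. -/
noncomputable def rotationCorrelation (F : (ι → ℝ) → ℝ) (t θ : ℝ) : ℝ :=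
  ∫ p, Real.exp (t * F p.1) * F (Real.cos θ • p.1 + Real.sin θ • p.2)
    ∂((stdGaussianPi ι).prod (stdGaussianPi ι))

lemma norm_combination_le (a b : ℝ) (ha : |a| ≤ 1) (hb : |b| ≤ 1) (p : (ι → ℝ) × (ι → ℝ)) :
    ‖a • p.1 + b • p.2‖ ≤ 2 * ‖p‖ := by
  refine (norm_add_le _ _).trans ?_
  rw [norm_smul, norm_smul, Real.norm_eq_abs, Real.norm_eq_abs]
  nlinarith [norm_fst_le p, norm_snd_le p, norm_nonneg p.1, norm_nonneg p.2]

lemma hasDerivAt_rotationCorrelation (hF : ∀ x, HasFDerivAt F (differential (G x)) x)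
    (hG : Measurable G) (hc : ∀ x y, ∑ i, G x i * G y i ≤ c) (t θ : ℝ) :
    HasDerivAt (rotationCorrelation F t)
      (∫ p, Real.exp (t * F p.1) * ∑ i, G (Real.cos θ • p.1 + Real.sin θ • p.2) i *
        (-Real.sin θ • p.1 + Real.cos θ • p.2) i
        ∂((stdGaussianPi ι).prod (stdGaussianPi ι))) θ := by
  set P := (stdGaussianPi ι).prod (stdGaussianPi ι)
  have hFm : Measurable F := (Differentiable.continuous fun x => (hF x).differentiableAt).measurable
  set L := Fintype.card ι * √c
  have hL : 0 ≤ L := by positivity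
  have hgr := abs_le_of_gradient hF hc
  have hexp : MemLp (fun p : (ι → ℝ) × (ι → ℝ) => Real.exp (t * F p.1)) 2 P := by
    refine memLp_two_exp_of_linear_growth (by fun_prop) (a := |t| * |F 0|) (L := |t| * L)
      fun p => ?_
    rw [abs_mul, mul_assoc, ← mul_add]
    refine mul_le_mul_of_nonneg_left ((hgr p.1).trans ?_) (abs_nonneg _)
    have := norm_fst_le p
    gcongr
  have hcos := Real.abs_cos_le_one
  have hsin := Real.abs_sin_le_one
  have hmeas : ∀ θ, Measurable fun p : (ι → ℝ) × (ι → ℝ) =>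
      F (Real.cos θ • p.1 + Real.sin θ • p.2) := fun θ => hFm.comp (by fun_prop)
  have hmeas' : Measurable fun p : (ι → ℝ) × (ι → ℝ) => ∑ i,
      G (Real.cos θ • p.1 + Real.sin θ • p.2) i * (-Real.sin θ • p.1 + Real.cos θ • p.2) i :=
    Finset.measurable_sum _ fun i _ =>
      (((measurable_pi_apply i).comp hG).comp (by fun_prop)).mul (by fun_prop)
  have hmexp : Measurable fun p : (ι → ℝ) × (ι → ℝ) => Real.exp (t * F p.1) := by fun_prop
  -- The dominating function does not depend on θ and is a product of two square-integrable
  -- functions, by linear growth.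
  refine (hasDerivAt_integral_of_dominated_loc_of_deriv_le (𝕜 := ℝ) (μ := P) (s := Set.univ)
    (F := fun θ (p : (ι → ℝ) × (ι → ℝ)) =>
      Real.exp (t * F p.1) * F (Real.cos θ • p.1 + Real.sin θ • p.2))
    (bound := fun p : (ι → ℝ) × (ι → ℝ) => Real.exp (t * F p.1) * (L * (2 * ‖p‖)))
    (F' := fun θ (p : (ι → ℝ) × (ι → ℝ)) => Real.exp (t * F p.1) * ∑ i, G (Real.cos θ • p.1 + Real.sin θ • p.2) i *
        (-Real.sin θ • p.1 + Real.cos θ • p.2) i) Filter.univ_mem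
    (Filter.Eventually.of_forall fun θ => (hmexp.mul (hmeas θ)).aestronglyMeasurable) ?_
    (hmexp.mul hmeas').aestronglyMeasurable ?_ ?_ ?_).2
  · refine hexp.integrable_mul (memLp_two_of_linear_growth (hmeas θ) (a := |F 0|)
      (L := L * 2) fun p => ?_)
    have := norm_combination_le _ _ (hcos θ) (hsin θ) p
    refine (hgr _).trans ?_
    have := mul_le_mul_of_nonneg_left this hL
    linarith
  · refine Filter.Eventually.of_forall fun p θ _ => ?_
    rw [norm_mul, Real.norm_eq_abs, Real.abs_exp, Real.norm_eq_abs]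
    refine mul_le_mul_of_nonneg_left ((abs_differential_le hc _ _).trans ?_) (Real.exp_nonneg _)
    exact mul_le_mul_of_nonneg_left
      (norm_combination_le _ _ (by rw [abs_neg]; exact hsin θ) (hcos θ) p) hL
  · refine hexp.integrable_mul (memLp_two_of_linear_growth (by fun_prop) (a := 0)
      (L := L * 2) fun p => ?_)
    rw [abs_of_nonneg (by positivity)]
    linarith
  · refine Filter.Eventually.of_forall fun p θ _ => ?_
    have h1 : HasDerivAt (fun θ => Real.cos θ • p.1 + Real.sin θ • p.2)
        (-Real.sin θ • p.1 + Real.cos θ • p.2) θ :=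
      ((Real.hasDerivAt_cos θ).smul_const _).add ((Real.hasDerivAt_sin θ).smul_const _)
    have h2 := ((hF _).comp_hasDerivAt θ h1).const_mul (Real.exp (t * F p.1))
    rw [differential_apply] at h2
    exact h2

lemma integral_comp_rotation {f : (ι → ℝ) × (ι → ℝ) → ℝ} (hf : Measurable f) (θ : ℝ) :
    ∫ p, f (Real.cos θ • p.1 + Real.sin θ • p.2, -Real.sin θ • p.1 + Real.cos θ • p.2)
      ∂((stdGaussianPi ι).prod (stdGaussianPi ι)) =
    ∫ p, f p ∂((stdGaussianPi ι).prod (stdGaussianPi ι)) := by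
  conv_rhs => rw [← IsGaussian.map_rotation_eq_self integral_id_stdGaussianPi θ]
  rw [integral_map (by fun_prop) hf.aestronglyMeasurable]
  rfl

lemma memLp_exp_comp_sub_smul (hF : ∀ x, HasFDerivAt F (differential (G x)) x)
    (hc : ∀ x y, ∑ i, G x i * G y i ≤ c) (t s : ℝ) (w : ι → ℝ) :
    MemLp (fun v => Real.exp (t * F (w - s • v))) 2 (stdGaussianPi ι) := by
  have hFm : Measurable F := (Differentiable.continuous fun x => (hF x).differentiableAt).measurable
  set L := Fintype.card ι * √c
  have hL : 0 ≤ L := by positivity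
  have hgr := abs_le_of_gradient hF hc
  refine memLp_two_exp_of_linear_growth (by fun_prop) (a := |t| * (|F 0| + L * ‖w‖))
    (L := |t| * L * |s|) fun v => ?_
  have h1 : ‖w - s • v‖ ≤ ‖w‖ + |s| * ‖v‖ := (norm_sub_le _ _).trans_eq (by
    rw [norm_smul, Real.norm_eq_abs])
  have h2 : |F (w - s • v)| ≤ |F 0| + L * (‖w‖ + |s| * ‖v‖) :=
    (hgr _).trans (by gcongr)
  rw [abs_mul]
  refine (mul_le_mul_of_nonneg_left h2 (abs_nonneg t)).trans_eq (by ring)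

/-- Gaussian integration by parts along a rotation. -/
lemma integral_exp_mul_apply [DecidableEq ι] (hF : ∀ x, HasFDerivAt F (differential (G x)) x)
    (hG : Measurable G) (hc : ∀ x y, ∑ i, G x i * G y i ≤ c) (t s : ℝ) (w : ι → ℝ) (i : ι) :
    ∫ v, v i * Real.exp (t * F (w - s • v)) ∂(stdGaussianPi ι) =
      ∫ v, -(t * s) * (G (w - s • v) i * Real.exp (t * F (w - s • v))) ∂(stdGaussianPi ι) := by
  have hexp := memLp_exp_comp_sub_smul hF hc t s w
  refine integral_apply_mul_stdGaussianPi i (fun x y => ?_) (hexp.integrable one_le_two) ?_ ?_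
  · have h0 : HasDerivAt (fun y => Function.update x i y) (Pi.single i (1 : ℝ)) y :=
      hasDerivAt_update x i y
    have h1 : HasDerivAt (fun y => w - s • Function.update x i y) (-(s • Pi.single i (1 : ℝ))) y :=
      (h0.const_smul s).const_sub w
    have h2 := (((hF _).comp_hasDerivAt y h1).const_mul t).exp
    refine h2.congr_deriv ?_
    rw [map_neg, map_smul, differential_apply]
    simp [Pi.single_apply]
    ring
  · refine Integrable.const_mul ?_ _
    refine (hexp.integrable one_le_two).bdd_mul (c := √c)
      (((measurable_pi_apply i).comp hG).comp (by fun_prop)).aestronglyMeasurable ?_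
    exact Filter.Eventually.of_forall fun v => abs_gradient_le hc _ i
  · have hv : MemLp (fun v : ι → ℝ => v i) 2 (stdGaussianPi ι) :=
      memLp_two_of_linear_growth (by fun_prop) (a := 0) (L := 1) fun v => by
        rw [zero_add, one_mul]; exact norm_le_pi_norm v i
    exact hv.integrable_mul hexp

end Interpolation

/-! ### Gaussian concentration -/

section Concentration

variable {ι : Type*} [Fintype ι] {F : (ι → ℝ) → ℝ} {G : (ι → ℝ) → ι → ℝ} {c : ℝ}

lemma memLp_apply_stdGaussianPi (i : ι) : MemLp (fun v : ι → ℝ => v i) 2 (stdGaussianPi ι) :=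
  memLp_two_of_linear_growth (by fun_prop) (a := 0) (L := 1) fun v => by
    rw [zero_add, one_mul]; exact norm_le_pi_norm v i

/-- Integrating each v_i by parts turns the right side into -ts times the mean of exp(tF(w - sv))
⟨G(u), G(w - sv)⟩, and the scalar product is at most c. This is where gradients at two different
points meet. -/
lemma neg_mul_integral_exp_le (hF : ∀ x, HasFDerivAt F (differential (G x)) x)
    (hG : Measurable G) (hc : ∀ x y, ∑ i, G x i * G y i ≤ c) {t s : ℝ} (hts : 0 ≤ t * s)
    (u w : ι → ℝ) :
    ∫ v, -(t * s * c) * Real.exp (t * F (w - s • v)) ∂(stdGaussianPi ι) ≤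
      ∫ v, Real.exp (t * F (w - s • v)) * ∑ i, G u i * v i ∂(stdGaussianPi ι) := by
  classical
  have hexp := memLp_exp_comp_sub_smul hF hc t s w
  have hGe : ∀ i, Integrable (fun v => G (w - s • v) i * Real.exp (t * F (w - s • v)))
      (stdGaussianPi ι) := fun i =>
    (hexp.integrable one_le_two).bdd_mul (c := √c)
      (((measurable_pi_apply i).comp hG).comp (by fun_prop)).aestronglyMeasurable
      (Filter.Eventually.of_forall fun v => abs_gradient_le hc _ i)
  have e1 : ∫ v, Real.exp (t * F (w - s • v)) * ∑ i, G u i * v i ∂(stdGaussianPi ι) =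
      ∑ i, ∫ v, G u i * (v i * Real.exp (t * F (w - s • v))) ∂(stdGaussianPi ι) := by
    have hi : ∀ i, Integrable (fun v => G u i * (v i * Real.exp (t * F (w - s • v))))
        (stdGaussianPi ι) := fun i =>
      ((memLp_apply_stdGaussianPi i).integrable_mul hexp).const_mul _
    rw [← integral_finsetSum _ fun i _ => hi i]
    refine integral_congr_ae (Filter.Eventually.of_forall fun v => ?_)
    simp only [Finset.mul_sum]
    exact Finset.sum_congr rfl fun i _ => by ring
  have e2 : ∑ i, ∫ v, G u i * (v i * Real.exp (t * F (w - s • v))) ∂(stdGaussianPi ι) =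
      ∑ i, ∫ v, G u i * (-(t * s) * (G (w - s • v) i * Real.exp (t * F (w - s • v))))
        ∂(stdGaussianPi ι) := by
    refine Finset.sum_congr rfl fun i _ => ?_
    rw [integral_const_mul, integral_const_mul, integral_exp_mul_apply hF hG hc]
  rw [e1, e2, ← integral_finsetSum _ fun i _ => ((hGe i).const_mul _).const_mul _]
  refine integral_mono ((hexp.integrable one_le_two).const_mul _)
    (integrable_finsetSum _ fun i _ => ((hGe i).const_mul _).const_mul _) fun v => ?_
  have h : ∑ i, G u i * (-(t * s) * (G (w - s • v) i * Real.exp (t * F (w - s • v)))) =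
      -(t * s) * Real.exp (t * F (w - s • v)) * ∑ i, G u i * G (w - s • v) i := by
    rw [Finset.mul_sum]
    exact Finset.sum_congr rfl fun i _ => by ring
  simp only
  rw [h]
  have := mul_le_mul_of_nonneg_left (hc u (w - s • v))
    (mul_nonneg hts (Real.exp_nonneg (t * F (w - s • v))))
  linarith

lemma integrable_exp_mul (hF : ∀ x, HasFDerivAt F (differential (G x)) x)
    (hc : ∀ x y, ∑ i, G x i * G y i ≤ c) (t : ℝ) :
    Integrable (fun x => Real.exp (t * F x)) (stdGaussianPi ι) := by
  -- With s = -1 and w = 0 the argument w - s • v is v itself.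
  simpa [neg_smul] using
    (memLp_exp_comp_sub_smul hF hc t (-1) 0).integrable one_le_two

lemma memLp_exp_combination (hF : ∀ x, HasFDerivAt F (differential (G x)) x)
    (hc : ∀ x y, ∑ i, G x i * G y i ≤ c) (t : ℝ) {a b : ℝ} (ha : |a| ≤ 1) (hb : |b| ≤ 1) :
    MemLp (fun p : (ι → ℝ) × (ι → ℝ) => Real.exp (t * F (a • p.1 - b • p.2))) 2
      ((stdGaussianPi ι).prod (stdGaussianPi ι)) := by
  have hFm : Measurable F := (Differentiable.continuous fun x => (hF x).differentiableAt).measurable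
  have hL : 0 ≤ Fintype.card ι * √c := by positivity
  refine memLp_two_exp_of_linear_growth ((hFm.comp (by fun_prop)).const_mul t)
    (a := |t| * |F 0|) (L := |t| * ((Fintype.card ι * √c) * 2)) fun p => ?_
  have h1 : ‖a • p.1 - b • p.2‖ ≤ 2 * ‖p‖ := by
    simpa [sub_eq_add_neg] using norm_combination_le a (-b) ha (by rwa [abs_neg]) p
  rw [abs_mul, mul_assoc, ← mul_add]
  refine mul_le_mul_of_nonneg_left ((abs_le_of_gradient hF hc _).trans ?_) (abs_nonneg _)
  have := mul_le_mul_of_nonneg_left h1 hL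
  linarith

/-- In the rotated pair (u, v) the original point is cos θ u - sin θ v, and the derivative is the
mean of exp(tF(cos θ u - sin θ v)) ⟨G(u), v⟩. For fixed u, `neg_mul_integral_exp_le` applies with w
= cos θ u and s = sin θ. -/
lemma deriv_rotationCorrelation_ge (hF : ∀ x, HasFDerivAt F (differential (G x)) x)
    (hG : Measurable G) (hc : ∀ x y, ∑ i, G x i * G y i ≤ c) {t θ : ℝ}
    (hts : 0 ≤ t * Real.sin θ) :
    -(t * Real.sin θ * c) * ∫ x, Real.exp (t * F x) ∂(stdGaussianPi ι) ≤
      deriv (rotationCorrelation F t) θ := by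
  rw [(hasDerivAt_rotationCorrelation hF hG hc t θ).deriv]
  have hFm : Measurable F := (Differentiable.continuous fun x => (hF x).differentiableAt).measurable
  have hGm : Measurable fun p : (ι → ℝ) × (ι → ℝ) => ∑ i, G p.1 i * p.2 i :=
    Finset.measurable_sum _ fun i _ =>
      (((measurable_pi_apply i).comp hG).comp measurable_fst).mul (by fun_prop)
  have hEm : Measurable fun p : (ι → ℝ) × (ι → ℝ) =>
      Real.exp (t * F (Real.cos θ • p.1 - Real.sin θ • p.2)) :=
    ((hFm.comp (by fun_prop)).const_mul t).exp
  have hrot : ∀ p : (ι → ℝ) × (ι → ℝ),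
      Real.cos θ • (Real.cos θ • p.1 + Real.sin θ • p.2) -
        Real.sin θ • (-Real.sin θ • p.1 + Real.cos θ • p.2) = p.1 := fun p => by
    funext i
    simp only [Pi.sub_apply, Pi.add_apply, Pi.smul_apply, smul_eq_mul]
    linear_combination (p.1 i) * Real.sin_sq_add_cos_sq θ
  have hexp := memLp_exp_combination hF hc t (Real.abs_cos_le_one θ) (Real.abs_sin_le_one θ)
  have hlin : MemLp (fun p : (ι → ℝ) × (ι → ℝ) => ∑ i, G p.1 i * p.2 i) 2
      ((stdGaussianPi ι).prod (stdGaussianPi ι)) :=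
    memLp_two_of_linear_growth hGm (a := 0) (L := Fintype.card ι * √c) fun p => by
      rw [zero_add]
      exact (abs_differential_le hc _ _).trans
        (mul_le_mul_of_nonneg_left (norm_snd_le p) (by positivity))
  have e1 := integral_comp_rotation (hEm.mul hGm) θ
  have e2 := integral_comp_rotation (hEm.const_mul (-(t * Real.sin θ * c))) θ
  simp only [Pi.mul_apply, hrot] at e1 e2
  have hi1 := hexp.integrable_mul hlin
  have hi2 := (hexp.integrable one_le_two).const_mul (-(t * Real.sin θ * c))
  have e3 : ∫ p : (ι → ℝ) × (ι → ℝ), -(t * Real.sin θ * c) * Real.exp (t * F p.1)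
      ∂((stdGaussianPi ι).prod (stdGaussianPi ι)) =
      -(t * Real.sin θ * c) * ∫ x, Real.exp (t * F x) ∂(stdGaussianPi ι) := by
    rw [integral_const_mul, integral_fun_fst (fun x => Real.exp (t * F x))]
    simp
  have e4 := integral_prod _ hi1
  simp only [Pi.mul_apply] at e4
  rw [e1, ← e3, e2, e4, integral_prod _ hi2]
  exact integral_mono hi2.integral_prod_left hi1.integral_prod_left fun u =>
    neg_mul_integral_exp_le hF hG hc hts u (Real.cos θ • u)

/-- Covariance bound: `E[F exp (tF)] ≤ (E F + t c) E[exp (tF)]` for `t ≥ 0`. -/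
lemma integral_mul_exp_le (hF : ∀ x, HasFDerivAt F (differential (G x)) x)
    (hG : Measurable G) (hc : ∀ x y, ∑ i, G x i * G y i ≤ c) {t : ℝ} (ht : 0 ≤ t) :
    ∫ x, F x * Real.exp (t * F x) ∂(stdGaussianPi ι) ≤
      (∫ x, F x ∂(stdGaussianPi ι) + t * c) * mgf F (stdGaussianPi ι) t := by
  set H := ∫ x, Real.exp (t * F x) ∂(stdGaussianPi ι) with hH
  have hd : ∀ θ, HasDerivAt (fun θ => rotationCorrelation F t θ - t * c * H * Real.cos θ)
      (deriv (rotationCorrelation F t) θ - t * c * H * -Real.sin θ) θ := fun θ =>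
    (hasDerivAt_rotationCorrelation hF hG hc t θ).differentiableAt.hasDerivAt.sub
      ((Real.hasDerivAt_cos θ).const_mul _)
  -- The cosine term integrates the lower bound -tcH sin θ on the derivative; comparing the
  -- endpoints costs exactly tcH.
  have hmono : MonotoneOn (fun θ => rotationCorrelation F t θ - t * c * H * Real.cos θ)
      (Set.Icc 0 (Real.pi / 2)) := by
    refine monotoneOn_of_deriv_nonneg (convex_Icc _ _)
      (fun θ _ => (hd θ).continuousAt.continuousWithinAt)
      (fun θ _ => (hd θ).differentiableAt.differentiableWithinAt) fun θ hθ => ?_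
    rw [interior_Icc] at hθ
    have hs : 0 ≤ Real.sin θ := Real.sin_nonneg_of_nonneg_of_le_pi hθ.1.le
      (by linarith [hθ.2, Real.pi_pos])
    rw [(hd θ).deriv]
    have := deriv_rotationCorrelation_ge hF hG hc (mul_nonneg ht hs)
    rw [← hH] at this
    linarith
  have h := hmono (Set.left_mem_Icc.2 (by positivity)) (Set.right_mem_Icc.2 (by positivity))
    (by positivity)
  have h0 : rotationCorrelation F t 0 = ∫ x, F x * Real.exp (t * F x) ∂(stdGaussianPi ι) := by
    simp only [rotationCorrelation, Real.cos_zero, Real.sin_zero, one_smul, zero_smul, add_zero]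
    rw [integral_fun_fst (fun x => Real.exp (t * F x) * F x)]
    simp [mul_comm]
  have h1 : rotationCorrelation F t (Real.pi / 2) = H * ∫ x, F x ∂(stdGaussianPi ι) := by
    simp only [rotationCorrelation, Real.cos_pi_div_two, Real.sin_pi_div_two, one_smul, zero_smul,
      zero_add]
    exact integral_prod_mul (fun x => Real.exp (t * F x)) F
  simp only [h0, h1, Real.cos_zero, Real.cos_pi_div_two] at h
  have : mgf F (stdGaussianPi ι) t = H := rfl
  rw [this]
  linarith

/-- The covariance bound reads M' ≤ (m + tc)M, so M(t) exp(-(tm + ct²/2)) decreases from its value 1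
at t = 0. -/
lemma mgf_le_of_nonneg (hF : ∀ x, HasFDerivAt F (differential (G x)) x)
    (hG : Measurable G) (hc : ∀ x y, ∑ i, G x i * G y i ≤ c) {t : ℝ} (ht : 0 ≤ t) :
    mgf F (stdGaussianPi ι) t ≤
      Real.exp (t * ∫ x, F x ∂(stdGaussianPi ι) + c * t ^ 2 / 2) := by
  set m := ∫ x, F x ∂(stdGaussianPi ι) with hm
  have hI : ∀ t, t ∈ interior (integrableExpSet F (stdGaussianPi ι)) := fun t => by
    have : integrableExpSet F (stdGaussianPi ι) = Set.univ :=
      Set.eq_univ_of_forall fun t => integrable_exp_mul hF hc t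
    simp [this]
  have hd : ∀ t, HasDerivAt (fun t => mgf F (stdGaussianPi ι) t *
      Real.exp (-(t * m + c * t ^ 2 / 2)))
      ((∫ x, F x * Real.exp (t * F x) ∂(stdGaussianPi ι) -
        (m + t * c) * mgf F (stdGaussianPi ι) t) * Real.exp (-(t * m + c * t ^ 2 / 2))) t := by
    intro t
    have h1 : HasDerivAt (fun t : ℝ => -(t * m + c * t ^ 2 / 2)) (-(m + t * c)) t := by
      have := ((((hasDerivAt_id t).mul_const m).add
        ((((hasDerivAt_id t).pow 2).const_mul c).div_const 2)).neg)
      refine this.congr_deriv ?_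
      simp
      ring
    refine ((hasDerivAt_mgf (hI t)).mul h1.exp).congr_deriv ?_
    ring
  have hanti : AntitoneOn (fun t => mgf F (stdGaussianPi ι) t *
      Real.exp (-(t * m + c * t ^ 2 / 2))) (Set.Ici 0) := by
    refine antitoneOn_of_deriv_nonpos (convex_Ici 0)
      (fun t _ => (hd t).continuousAt.continuousWithinAt)
      (fun t _ => (hd t).differentiableAt.differentiableWithinAt) fun t ht => ?_
    rw [interior_Ici] at ht
    rw [(hd t).deriv]
    exact mul_nonpos_of_nonpos_of_nonneg
      (sub_nonpos.2 (integral_mul_exp_le hF hG hc (le_of_lt ht))) (Real.exp_nonneg _)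
  have h := hanti Set.self_mem_Ici ht ht
  simp only [mgf_zero, zero_mul] at h
  rw [Real.exp_neg, ← div_eq_mul_inv, div_le_iff₀ (Real.exp_pos _)] at h
  simpa using h

/-- **Gaussian concentration**: a function of a standard Gaussian vector whose gradients at any
two points have scalar product at most `c` is sub-Gaussian around its mean, with parameter `c`. -/
theorem hasSubgaussianMGF_of_gradient {c : NNReal}
    (hF : ∀ x, HasFDerivAt F (differential (G x)) x)
    (hG : Measurable G) (hc : ∀ x y, ∑ i, G x i * G y i ≤ c) :
    HasSubgaussianMGF (fun x => F x - ∫ y, F y ∂(stdGaussianPi ι)) c (stdGaussianPi ι) := by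
  set m := ∫ y, F y ∂(stdGaussianPi ι) with hm
  have hsub : ∀ t x, Real.exp (t * (F x - m)) = Real.exp (t * F x) * Real.exp (-(t * m)) :=
    fun t x => by rw [← Real.exp_add]; ring_nf
  refine ⟨fun t => ?_, fun t => ?_⟩
  · simp only [hsub]
    exact (integrable_exp_mul hF hc t).mul_const _
  have hle : mgf F (stdGaussianPi ι) t ≤ Real.exp (t * m + c * t ^ 2 / 2) := by
    rcases le_total 0 t with ht | ht
    · exact mgf_le_of_nonneg hF hG hc ht
    -- Negative t reduces to -F at -t; the scalar products of gradients are unchanged.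
    · have h := mgf_le_of_nonneg (F := fun x => -F x) (G := fun x => -G x) (c := c)
        (fun x => by
          refine (hF x).neg.congr_fderiv ?_
          refine ContinuousLinearMap.ext fun v => ?_
          rw [neg_apply, differential_apply, differential_apply]
          simp) hG.neg (fun x y => by simpa using hc x y) (neg_nonneg.2 ht)
      have e : mgf (fun x => -F x) (stdGaussianPi ι) (-t) = mgf F (stdGaussianPi ι) t := by
        simp [mgf]
      rw [e, integral_neg, ← hm] at h
      simpa using h
  have e : mgf (fun x => F x - m) (stdGaussianPi ι) t =
      mgf F (stdGaussianPi ι) t * Real.exp (-(t * m)) := by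
    simp only [mgf, hsub, integral_mul_const]
  rw [e]
  refine (mul_le_mul_of_nonneg_right hle (Real.exp_nonneg _)).trans_eq ?_
  rw [← Real.exp_add]
  ring_nf

end Concentration

end GaussianConcentration

namespace CombTest

open GaussianConcentration

/-! ### Smoothing of the scan statistic and its upper tail -/

section SoftScan

variable {n : ℕ} (C : Finset (Finset (Fin n)))

/-- The partition function of the scan statistic at temperature `η`. -/
noncomputable def scanPartition (η : ℝ) (x : Fin n → ℝ) : ℝ :=
  ∑ S ∈ C, Real.exp ((∑ i ∈ S, x i) / η)

/-- The log-sum-exp smoothing of the scan statistic at temperature `η`. -/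
noncomputable def softScan (η : ℝ) (x : Fin n → ℝ) : ℝ :=
  η * Real.log (scanPartition C η x)

/-- The gradient of `softScan`: the inclusion probabilities of the coordinates under the Gibbs
measure on `C`. -/
noncomputable def softScanGradient (η : ℝ) (x : Fin n → ℝ) (i : Fin n) : ℝ :=
  (∑ S ∈ C, Real.exp ((∑ j ∈ S, x j) / η) * (if i ∈ S then 1 else 0)) / scanPartition C η x

variable {C}

lemma scanPartition_pos (hC : C.Nonempty) (η : ℝ) (x : Fin n → ℝ) : 0 < scanPartition C η x :=
  Finset.sum_pos (fun _ _ => Real.exp_pos _) hC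

lemma hasFDerivAt_softScan (hC : C.Nonempty) {η : ℝ} (hη : 0 < η) (x : Fin n → ℝ) :
    HasFDerivAt (softScan C η) (differential (softScanGradient C η x)) x := by
  have hS : ∀ S : Finset (Fin n), HasFDerivAt (fun x : Fin n → ℝ => ∑ i ∈ S, x i)
      (differential fun i => if i ∈ S then 1 else 0) x := fun S => by
    have h := HasFDerivAt.fun_sum (u := S) fun i _ =>
      (ContinuousLinearMap.proj (R := ℝ) (φ := fun _ : Fin n => ℝ) i).hasFDerivAt (x := x)
    refine h.congr_fderiv ?_
    ext v
    simp [differential_apply]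
  have hZ : HasFDerivAt (scanPartition C η) (∑ S ∈ C, Real.exp ((∑ i ∈ S, x i) / η) •
      (η⁻¹ • differential fun i => if i ∈ S then 1 else 0)) x :=
    HasFDerivAt.fun_sum fun S _ => by
      have h := ((hS S).const_mul η⁻¹).exp
      simpa only [← div_eq_inv_mul] using h
  refine ((hZ.log (scanPartition_pos hC η x).ne').const_mul η).congr_fderiv ?_
  ext v
  have hZ0 := (scanPartition_pos hC η x).ne'
  simp only [smul_apply, sum_apply, differential_apply,
    softScanGradient, smul_eq_mul]
  simp only [Finset.mul_sum, div_mul_eq_mul_div, Finset.sum_mul, Finset.sum_div]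
  rw [Finset.sum_comm]
  refine Finset.sum_congr rfl fun i _ => Finset.sum_congr rfl fun S _ => ?_
  field_simp

lemma measurable_softScanGradient (η : ℝ) : Measurable (softScanGradient C η) := by
  refine measurable_pi_lambda _ fun i => ?_
  unfold softScanGradient scanPartition
  fun_prop

lemma softScanGradient_nonneg (η : ℝ) (x : Fin n → ℝ) (i : Fin n) :
    0 ≤ softScanGradient C η x i :=
  div_nonneg (Finset.sum_nonneg fun S _ => by positivity)
    (Finset.sum_nonneg fun _ _ => Real.exp_nonneg _)

lemma softScanGradient_le_one (η : ℝ) (x : Fin n → ℝ) (i : Fin n) :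
    softScanGradient C η x i ≤ 1 := by
  refine div_le_one_of_le₀ (Finset.sum_le_sum fun S _ => ?_)
    (Finset.sum_nonneg fun _ _ => Real.exp_nonneg _)
  split_ifs <;> simp [Real.exp_nonneg]

lemma sum_softScanGradient (hC : C.Nonempty) {K : ℕ} (hcard : ∀ S ∈ C, S.card = K) (η : ℝ)
    (x : Fin n → ℝ) : ∑ i, softScanGradient C η x i = K := by
  simp only [softScanGradient]
  rw [← Finset.sum_div, div_eq_iff (scanPartition_pos hC η x).ne', Finset.sum_comm, scanPartition,
    Finset.mul_sum]
  refine Finset.sum_congr rfl fun S hS => ?_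
  rw [← Finset.mul_sum]
  simp [hcard S hS, mul_comm]

/-- One gradient has nonnegative entries summing to K, the other has entries at most 1. This gives
variance parameter K, whatever n and the size of the class. -/
lemma sum_softScanGradient_mul_le (hC : C.Nonempty) {K : ℕ} (hcard : ∀ S ∈ C, S.card = K) (η : ℝ)
    (x y : Fin n → ℝ) : ∑ i, softScanGradient C η x i * softScanGradient C η y i ≤ K := by
  rw [← sum_softScanGradient hC hcard η x]
  exact Finset.sum_le_sum fun i _ => mul_le_of_le_one_right (softScanGradient_nonneg η x i)
    (softScanGradient_le_one η y i)

lemma scan_le_softScan (hC : C.Nonempty) {η : ℝ} (hη : 0 < η) (x : Fin n → ℝ) :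
    scan C hC x ≤ softScan C η x := by
  refine Finset.sup'_le _ _ fun S hS => ?_
  have h : Real.exp ((∑ i ∈ S, x i) / η) ≤ scanPartition C η x :=
    Finset.single_le_sum (f := fun S => Real.exp ((∑ i ∈ S, x i) / η))
      (fun _ _ => Real.exp_nonneg _) hS
  rw [← Real.le_log_iff_exp_le (scanPartition_pos hC η x), div_le_iff₀ hη] at h
  rwa [softScan, mul_comm]

lemma softScan_le_scan_add (hC : C.Nonempty) {η : ℝ} (hη : 0 < η) (x : Fin n → ℝ) :
    softScan C η x ≤ scan C hC x + η * Real.log C.card := by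
  have h : scanPartition C η x ≤ C.card * Real.exp (scan C hC x / η) := by
    rw [← nsmul_eq_mul]
    refine Finset.sum_le_card_nsmul _ _ _ fun S hS => Real.exp_le_exp.2 ?_
    exact div_le_div_of_nonneg_right
      (Finset.le_sup' (fun S : Finset (Fin n) => ∑ i ∈ S, x i) hS) hη.le
  have hN : (C.card : ℝ) ≠ 0 := by exact_mod_cast hC.card_pos.ne'
  have h2 := Real.log_le_log (scanPartition_pos hC η x) h
  rw [Real.log_mul hN (Real.exp_pos _).ne', Real.log_exp] at h2
  refine (mul_le_mul_of_nonneg_left h2 hη.le).trans_eq ?_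
  field_simp
  ring

/-- Gaussian concentration of the scan statistic above its mean. -/
lemma measureReal_scan_ge_le (hC : C.Nonempty) {K : ℕ} (hcard : ∀ S ∈ C, S.card = K) {t : ℝ}
    (ht : 0 ≤ t) :
    (nullLaw n).real {x | scanMean C hC + t ≤ scan C hC x} ≤ Real.exp (-t ^ 2 / (2 * K)) := by
  have : IsProbabilityMeasure (nullLaw n) := by unfold nullLaw; infer_instance
  -- At t = 0 the bound is 1; otherwise ε can be taken in (0, t).
  rcases ht.eq_or_lt with rfl | ht
  · simp
  have hlim : Filter.Tendsto (fun ε : ℝ => Real.exp (-(t - ε) ^ 2 / (2 * K)))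
      (nhdsWithin 0 (Set.Ioi 0)) (nhds (Real.exp (-t ^ 2 / (2 * K)))) := by
    have hcont : Continuous fun ε : ℝ => Real.exp (-(t - ε) ^ 2 / (2 * K)) := by fun_prop
    simpa using (hcont.tendsto 0).mono_left nhdsWithin_le_nhds
  refine ge_of_tendsto hlim ?_
  filter_upwards [Ioo_mem_nhdsGT ht] with ε hε
  have hlog : 0 ≤ Real.log C.card := Real.log_natCast_nonneg _
  -- The temperature keeps the smoothing error within ε; the added 1 avoids a zero denominator for a
  -- one-element class.
  set η := ε / (Real.log C.card + 1) with hηdef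
  have hη : 0 < η := div_pos hε.1 (by positivity)
  have hηε : η * Real.log C.card ≤ ε := by
    rw [hηdef, div_mul_eq_mul_div, div_le_iff₀ (by positivity)]
    linarith [hε.1]
  have hsub : HasSubgaussianMGF (fun x => softScan C η x - ∫ y, softScan C η y ∂(nullLaw n))
      (K : NNReal) (nullLaw n) :=
    hasSubgaussianMGF_of_gradient (hasFDerivAt_softScan hC hη) (measurable_softScanGradient η)
      (sum_softScanGradient_mul_le hC hcard η)
  have hint : Integrable (softScan C η) (nullLaw n) := by
    refine (hsub.integrable.add (integrable_const (∫ y, softScan C η y ∂(nullLaw n)))).congr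
      (Filter.Eventually.of_forall fun x => ?_)
    simp only [Pi.add_apply, sub_add_cancel]
  have hmean : ∫ y, softScan C η y ∂(nullLaw n) ≤ scanMean C hC + ε := by
    refine (integral_mono hint ((integrable_scan C hC).add (integrable_const ε)) fun x =>
      (softScan_le_scan_add hC hη x).trans (by simpa using hηε)).trans_eq ?_
    simp only [Pi.add_apply]
    rw [integral_add (integrable_scan C hC) (integrable_const ε)]
    simp [scanMean]
  refine (measureReal_mono fun x hx => ?_).trans (hsub.measure_ge_le (sub_nonneg.2 hε.2.le))
  have := scan_le_softScan hC hη x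
  simp only [Set.mem_ofPred_eq] at hx ⊢
  linarith

end SoftScan

/-! ### Lower tail of X_S under the alternative -/

section Alternative

lemma hasSubgaussianMGF_sub_gaussianReal (m : ℝ) :
    HasSubgaussianMGF (fun x => m - x) 1 (gaussianReal m 1) := by
  refine (HasSubgaussianMGF.id_map_iff (by fun_prop)).1 ?_
  rw [gaussianReal_map_const_sub, sub_self]
  refine ⟨fun t => integrable_exp_mul_gaussianReal t, fun t => ?_⟩
  rw [mgf_id_gaussianReal]
  simp

lemma measureReal_altLaw_sum_le {n K : ℕ} {S : Finset (Fin n)} (hS : S.card = K) (μ : ℝ) {t : ℝ}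
    (ht : 0 ≤ t) :
    (altLaw μ S).real {x | ∑ i ∈ S, x i ≤ μ * K - t} ≤ Real.exp (-t ^ 2 / (2 * K)) := by
  -- The sign is reversed so that the lower tail of X_S becomes an upper tail of independent centred
  -- sub-Gaussian variables.
  have hind : iIndepFun (fun (i : Fin n) (x : Fin n → ℝ) => (if i ∈ S then μ else 0) - x i)
      (altLaw μ S) :=
    iIndepFun_pi (μ := fun i => gaussianReal (if i ∈ S then μ else 0) 1)
      (X := fun i y => (if i ∈ S then μ else 0) - y) fun i => by fun_prop
  have hsub : ∀ i ∈ S, HasSubgaussianMGF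
      (fun x : Fin n → ℝ => (if i ∈ S then μ else 0) - x i) 1 (altLaw μ S) := fun i _ => by
    have hmp := measurePreserving_eval
      (fun i => gaussianReal (if i ∈ S then μ else 0) 1) i
    have h := hasSubgaussianMGF_sub_gaussianReal (if i ∈ S then μ else 0)
    rw [← hmp.map_eq] at h
    exact HasSubgaussianMGF.of_map hmp.measurable.aemeasurable h
  have h := HasSubgaussianMGF.measure_sum_ge_le_of_iIndepFun hind hsub ht
  have hset : {x : Fin n → ℝ | t ≤ ∑ i ∈ S, ((if i ∈ S then μ else 0) - x i)} =
      {x | ∑ i ∈ S, x i ≤ μ * K - t} := by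
    ext x
    have : ∑ i ∈ S, ((if i ∈ S then μ else 0) - x i) = μ * K - ∑ i ∈ S, x i := by
      rw [Finset.sum_sub_distrib, Finset.sum_congr rfl fun i hi => if_pos hi]
      simp [hS, mul_comm]
    simp only [Set.mem_ofPred_eq, this]
    constructor <;> intro h <;> linarith
  rw [hset] at h
  simpa [hS] using h

end Alternative

/-! ### Risk of the maximum test -/

section Risk

variable {n : ℕ} {C : Finset (Finset (Fin n))}

lemma risk_le_add {μ a b : ℝ} {f : (Fin n → ℝ) → Fin 2} (hC : C.Nonempty)
    (h0 : (nullLaw n).real {x | f x = 1} ≤ a)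
    (h1 : ∀ S ∈ C, (altLaw μ S).real {x | f x = 0} ≤ b) : risk C μ f ≤ a + b := by
  refine add_le_add h0 ?_
  have hN : (0 : ℝ) < C.card := by exact_mod_cast hC.card_pos
  rw [one_div_mul_eq_div, div_le_iff₀ hN, mul_comm, ← nsmul_eq_mul]
  exact Finset.sum_le_card_nsmul _ _ _ h1

lemma maxTest_eq_one_iff (hC : C.Nonempty) {K : ℕ} {μ : ℝ} {x : Fin n → ℝ} :
    maxTest C hC K μ x = 1 ↔ (μ * K + scanMean C hC) / 2 ≤ scan C hC x := by
  unfold maxTest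
  split_ifs with h <;> simp [h]

lemma maxTest_eq_zero_iff (hC : C.Nonempty) {K : ℕ} {μ : ℝ} {x : Fin n → ℝ} :
    maxTest C hC K μ x = 0 ↔ scan C hC x < (μ * K + scanMean C hC) / 2 := by
  unfold maxTest
  split_ifs with h
  · simpa using h
  · simpa using h

lemma risk_maxTest_le (hC : C.Nonempty) {K : ℕ} (hcard : ∀ S ∈ C, S.card = K) {μ t : ℝ}
    (ht : 0 ≤ t) (h : t = (μ * K - scanMean C hC) / 2) :
    risk C μ (maxTest C hC K μ) ≤ 2 * Real.exp (-t ^ 2 / (2 * K)) := by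
  rw [two_mul]
  refine risk_le_add hC ?_ fun S hS => ?_
  · refine le_trans (le_of_eq ?_) (measureReal_scan_ge_le hC hcard ht)
    congr 1
    ext x
    rw [Set.mem_ofPred_eq, Set.mem_ofPred_eq, maxTest_eq_one_iff, h]
    ring_nf
  · have : IsProbabilityMeasure (altLaw μ S) := by unfold altLaw; infer_instance
    refine (measureReal_mono fun x hx => ?_).trans (measureReal_altLaw_sum_le (hcard S hS) μ ht)
    rw [Set.mem_ofPred_eq, maxTest_eq_zero_iff] at hx
    have hle : ∑ i ∈ S, x i ≤ scan C hC x :=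
      Finset.le_sup' (fun S : Finset (Fin n) => ∑ i ∈ S, x i) hS
    rw [Set.mem_ofPred_eq, h]
    linarith

end Risk

end CombTest

theorem mainTheorem6 (n K : ℕ) (hK : 1 ≤ K) (C : Finset (Finset (Fin n))) (hC : C.Nonempty)
    (hcard : ∀ S ∈ C, S.card = K) (μ : ℝ) (hμ : 0 < μ) (δ : ℝ) (hδ : 0 < δ)
    (h : CombTest.scanMean C hC / K + 2 * Real.sqrt (2 / K * Real.log (2 / δ)) ≤ μ) :
    CombTest.risk C μ (CombTest.maxTest C hC K μ) ≤ δ := by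
  have hK0 : (0 : ℝ) < K := by exact_mod_cast hK
  set r := Real.sqrt (2 / K * Real.log (2 / δ)) with hr
  have hr0 : 0 ≤ r := Real.sqrt_nonneg _
  have ht : K * r ≤ (μ * K - CombTest.scanMean C hC) / 2 := by
    have h1 := mul_le_mul_of_nonneg_right h hK0.le
    rw [add_mul, div_mul_cancel₀ _ hK0.ne'] at h1
    linarith
  have ht0 : 0 ≤ (μ * K - CombTest.scanMean C hC) / 2 := (by positivity : 0 ≤ K * r).trans ht
  refine (CombTest.risk_maxTest_le hC hcard ht0 rfl).trans ?_
  set t := (μ * K - CombTest.scanMean C hC) / 2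
  have hexp : Real.exp (-t ^ 2 / (2 * K)) ≤ δ / 2 := by
    rw [← Real.le_log_iff_exp_le (by positivity), div_le_iff₀ (by positivity)]
    have hlog : Real.log (δ / 2) = -Real.log (2 / δ) := by
      rw [← Real.log_inv, inv_div]
    -- Only an inequality: for δ > 2 the logarithm is negative and r = 0.
    have hsq : 2 / K * Real.log (2 / δ) ≤ r ^ 2 := by
      rw [hr, Real.sq_sqrt']
      exact le_max_left _ _
    have h2 : (K * r) ^ 2 ≤ t ^ 2 := pow_le_pow_left₀ (by positivity) ht 2
    have h3 : (K : ℝ) ^ 2 * (2 / K * Real.log (2 / δ)) ≤ (K : ℝ) ^ 2 * r ^ 2 := by gcongr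
    have h4 : (K : ℝ) ^ 2 * (2 / K * Real.log (2 / δ)) = 2 * K * Real.log (2 / δ) := by
      field_simp
    rw [hlog]
    nlinarith
  linarith
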